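/- Let $G=(V,E)$ be a finite multigraph with $n=|V|$ vertices; parallel edges are allowed, and so are loops. The vertices are the agents and the edges are the goods. Each agent $i\in V$ has a valuation $v_i:2^E\to\mathbb{R}$ that is normalized ($v_i(\emptyset)=0$), monotone ($v_i(S)\le v_i(T)$ whenever $S\subseteq T\subseteq E$), and indifferent to goods not incident to $i$: $v_i(S\cup\{g\})=v_i(S)$ for every $S\subseteq E$ and every edge $g$ that does not have $i$ as an endpoint. Suppose that every agent has at most $\lceil n/4\rceil-1$ neighbors, where a neighbor of $i$ is a vertex $j\neq i$ joined to $i$ by at least one edge (so parallel edges count once). Then there is a complete EFX allocation, that is, a partition of $E$ into pairwise disjoint, possibly empty, bundles $(X_i)_{i\in V}$ with $\bigcup_{i\in V}X_i=E$ such that for all agents $i,j$ and every good $g\in X_j$, $$v_i(X_i)\ \ge\ v_i(X_j\setminus\{g\}).$$ -/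

import Mathlib

namespace MultigraphEFX

universe u w

variable {α : Type u} {β : Type w}

/-- The agents are the vertices of the multigraph `G`. -/
abbrev Agent (G : Graph α β) : Type u := ↥G.vertexSet

/-- The goods are the edges of the multigraph `G`. -/
abbrev Good (G : Graph α β) : Type w := ↥G.edgeSet

/-- The good `g` is relevant to agent `i` if the edge `g` has `i` as an endpoint. -/
def Relevant (G : Graph α β) (i : Agent G) (g : Good G) : Prop :=
  G.Inc (g : β) (i : α)

/-- The neighbours of `i`: the agents other than `i` joined to `i` by at least one edge. -/
def neighbors (G : Graph α β) (i : Agent G) : Set (Agent G) :=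
  {j | j ≠ i ∧ G.Adj (i : α) (j : α)}

/-- A valuation function of agent `i` in the multigraph setting: normalized, monotone, and such
that goods irrelevant to `i` have zero marginal value. -/
structure IsValuation (G : Graph α β) (i : Agent G) (v : Set (Good G) → ℝ) : Prop where
  empty : v ∅ = 0
  mono : ∀ S T : Set (Good G), S ⊆ T → v S ≤ v T
  irrelevant : ∀ (S : Set (Good G)) (g : Good G), ¬ Relevant G i g → v (S ∪ {g}) = v S

/-- An allocation assigns pairwise disjoint bundles to the agents. -/
def IsAllocation (G : Graph α β) (X : Agent G → Set (Good G)) : Prop :=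
  ∀ i j : Agent G, i ≠ j → Disjoint (X i) (X j)

/-- A complete allocation hands out every good. -/
def IsCompleteAllocation (G : Graph α β) (X : Agent G → Set (Good G)) : Prop :=
  IsAllocation G X ∧ ⋃ i, X i = Set.univ

/-- Envy-freeness up to any good: every agent `i` values its own bundle at least as much as what
remains of the bundle of any agent `j` after the removal of any single good from it. -/
def IsEFX (G : Graph α β) (v : Agent G → Set (Good G) → ℝ) (X : Agent G → Set (Good G)) : Prop :=
  ∀ i j : Agent G, ∀ g ∈ X j, v i (X j \ {g}) ≤ v i (X i)

end MultigraphEFX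

/-! ### Valuations when every good interests at most two agents -/

namespace MultigraphEFX

/-! Call an agent that nobody envies a root. As a good interests at most two agents, goods can
safely be added to the bundle of a root if nobody interested in them is interested in that bundle.
With few neighbours around the endpoints of an edge, few roots are ruled out for it. So the task is
to find a partial EFX allocation with many roots, whose leftovers nobody prefers to its own bundle.

Roots come from a contest: each claim is held by one agent or by two mates, and contested agents
also have fallbacks. In a Pareto-maximal contest, nobody prefers to its fallback the unclaimed goods
shared with one other agent (`exists_stable`). The contested agents are two-coloured so that mates,
and agents sharing a fallback, differ; one colour then yields to its mates. The sets of agents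
possibly envied under a colouring and under its reverse are disjoint (`disjoint_enviedSet`), so one
of the two leaves at least half of the agents as roots. Fallbacks not used become the reserve.

An agent may still prefer the whole pool, although no part of it shared with a single agent.
Maximizing first the number of roots and then the total value excludes this (`exists_pool_le`).

Finally reserve and pool go to roots. The endpoints of an edge and their neighbours number less than
`n / 2`, which leaves a free root; a reserved bundle handed out blocks at most one more root for a
good, and only where it was itself counted as touching (`IsSpread.give`). -/

/-- A fair division instance in which every good is relevant to at most two agents and the value of
a bundle to an agent depends monotonically on the relevant goods in it. -/
structure Market (V E : Type*) where
  rel : V → E → Prop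
  rel_two : ∀ g a b c, rel a g → rel b g → rel c g → a = b ∨ a = c ∨ b = c
  v : V → Set E → ℝ
  v_empty : ∀ i, v i ∅ = 0
  v_le : ∀ i S T, (∀ g ∈ S, rel i g → g ∈ T) → v i S ≤ v i T

namespace Market

variable {V E : Type*} (M : Market V E)

/-- All goods of the bundle are relevant to the same agents. -/
def Parallel (S : Set E) : Prop := ∀ g ∈ S, ∀ h ∈ S, ∀ a, M.rel a g → M.rel a h

/-- The goods relevant to both `i` and `j`. -/
def common (i j : V) : Set E := {g | M.rel i g ∧ M.rel j g}

/-- The agents other than `i` that share a relevant good with `i`. -/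
def nbrs (i : V) : Set V := {j | j ≠ i ∧ ∃ g, M.rel i g ∧ M.rel j g}

variable {M}

theorem v_mono {i : V} {S T : Set E} (h : S ⊆ T) : M.v i S ≤ M.v i T :=
  M.v_le i S T fun _ hg _ => h hg

theorem v_nonneg (i : V) (S : Set E) : 0 ≤ M.v i S :=
  (M.v_empty i).symm.trans_le (v_mono (Set.empty_subset S))

theorem v_eq_zero {i : V} {S : Set E} (h : ∀ g ∈ S, ¬ M.rel i g) : M.v i S = 0 :=
  le_antisymm ((M.v_le i S ∅ fun g hg hr => (h g hg hr).elim).trans_eq (M.v_empty i))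
    (v_nonneg i S)

theorem exists_rel_of_lt {i : V} {S : Set E} {x : ℝ} (hx : 0 ≤ x) (h : x < M.v i S) :
    ∃ g ∈ S, M.rel i g := by
  by_contra! hc
  rw [v_eq_zero hc] at h
  exact absurd h hx.not_gt

theorem Parallel.empty : M.Parallel ∅ := fun _ hg => hg.elim

/-- If `i` envies a parallel bundle, then all its goods are relevant to `i`. -/
theorem Parallel.rel_of_lt {i : V} {S : Set E} (hS : M.Parallel S) {x : ℝ} (hx : 0 ≤ x)
    (h : x < M.v i S) : ∀ g ∈ S, M.rel i g := by
  obtain ⟨g, hg, hr⟩ := exists_rel_of_lt hx h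
  exact fun k hk => hS g hg k hk i hr

theorem parallel_of_common {i j : V} (hij : i ≠ j) {S : Set E} (h : S ⊆ M.common i j) :
    M.Parallel S := by
  intro g hg k hk a ha
  have h1 := h hg
  have h2 := h hk
  rcases M.rel_two g a i j ha h1.1 h1.2 with rfl | rfl | h3
  · exact h2.1
  · exact h2.2
  · exact (hij h3).elim

/-- A minimal bundle of common goods that raises the level of one of two agents. -/
theorem exists_minimal_lt [Finite E] {i j : V} {S : Set E} {L : V → ℝ} (h : L i < M.v i S) :
    ∃ Z ⊆ S, (L i < M.v i Z ∨ L j < M.v j Z) ∧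
      ∀ g ∈ Z, M.v i (Z \ {g}) ≤ L i ∧ M.v j (Z \ {g}) ≤ L j := by
  obtain ⟨Z, hZ⟩ := (Set.toFinite {Z : Set E | Z ⊆ S ∧ (L i < M.v i Z ∨ L j < M.v j Z)}
    ).exists_minimal ⟨S, subset_rfl, Or.inl h⟩
  refine ⟨Z, hZ.prop.1, hZ.prop.2, fun g hg => ?_⟩
  by_contra hc
  have h2 : L i < M.v i (Z \ {g}) ∨ L j < M.v j (Z \ {g}) := by
    by_contra! h3
    exact hc h3
  have := hZ.le_of_le (y := Z \ {g}) ⟨Set.sdiff_subset.trans hZ.prop.1, h2⟩ Set.sdiff_subset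
  exact (this hg).2 rfl

end Market

/-! ### Two-colouring the union of two matchings -/

/-- Two involutions admit a common proper two-colouring. -/
theorem exists_coloring_of_involutive {V : Type*} [Finite V] {p s : V → V}
    (hp : Function.Involutive p) (hs : Function.Involutive s) :
    ∃ c : V → Bool, ∀ x, (p x ≠ x → c (p x) ≠ c x) ∧ (s x ≠ x → c (s x) ≠ c x) := by
  classical
  obtain ⟨n, hn⟩ : ∃ n, {x | p x ≠ x}.ncard = n := ⟨_, rfl⟩
  induction n using Nat.strong_induction_on generalizing p s with
  | _ n ih =>
    by_cases hall : ∀ x, p x = x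
    -- Only the pairs of `s` remain, and any linear order tells their two members apart.
    · let _ : LinearOrder V := linearOrderOfSTO WellOrderingRel
      refine ⟨fun x => decide (x < s x), fun x => ⟨fun h => (h (hall x)).elim, fun h => ?_⟩⟩
      have := hs x
      rcases lt_or_gt_of_ne h with h1 | h1
      · simp [this, h1, h1.not_gt]
      · simp [this, h1, h1.not_gt]
    · push Not at hall
      obtain ⟨u, hpu⟩ := hall
      obtain ⟨v, hv⟩ : ∃ v, v = p u := ⟨_, rfl⟩
      have hpv : p v = u := hv ▸ hp u
      have huv : v ≠ u := hv ▸ hpu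
      have hsu := hs u
      have hsv := hs v
      -- The pair `u`, `v` is deleted and its outer `s`-partners are matched to each other: the path
      -- `s u`, `u`, `v`, `s v` shrinks to an edge. Its ends get different colours, so the path can
      -- be restored with alternating colours.
      let p' : V → V := fun x => if x = u ∨ x = v then x else p x
      let s' : V → V := fun x =>
        if x = u ∨ x = v then x
        else if s x = u then (if s v = v ∨ s v = u then x else s v)
        else if s x = v then (if s u = u ∨ s u = v then x else s u)
        else s x
      have hp' : Function.Involutive p' := by
        intro x
        have := hp x
        clear ih hn hp hs hsu hsv
        simp only [p']
        grind
      have hs' : Function.Involutive s' := by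
        intro x
        have hx := hs x
        clear ih hn hp hs
        simp only [s']
        grind
      have hcard : {x | p' x ≠ x}.ncard < n := by
        rw [← hn]
        refine Set.ncard_lt_ncard ⟨fun x hx => ?_, fun h => ?_⟩ (Set.toFinite _)
        · simp only [p', Set.mem_ofPred_eq] at hx ⊢
          by_cases h : x = u ∨ x = v
          · rw [if_pos h] at hx
            exact (hx rfl).elim
          · rwa [if_neg h] at hx
        · exact h (show u ∈ {x | p x ≠ x} from hpu) (by simp [p'])
      obtain ⟨c, hc⟩ := ih _ hcard hp' hs' rfl
      have h1 : ∀ x, x ≠ u → x ≠ v → p x ≠ x → c (p x) ≠ c x := by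
        intro x hxu hxv hx
        have := (hc x).1
        simp only [p', hxu, hxv, or_self, if_false] at this
        exact this hx
      have h2 : ∀ x, x ≠ u → x ≠ v → s x ≠ u → s x ≠ v → s x ≠ x → c (s x) ≠ c x := by
        intro x hxu hxv hu hv hx
        have := (hc x).2
        simp only [s', hxu, hxv, hu, hv, or_self, if_false] at this
        exact this hx
      have h3 : s u ≠ u → s u ≠ v → s v ≠ u → s v ≠ v → c (s v) ≠ c (s u) := by
        intro a1 a2 a3 a4
        have := (hc (s u)).2
        simp only [s', a1, a2, a3, a4, hsu, or_self, if_false, if_true] at this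
        exact this fun h => huv (by rw [← hsv, h, hsu])
      obtain ⟨b, hb1, hb2⟩ : ∃ b : Bool, (s u ≠ u → s u ≠ v → c (s u) ≠ b) ∧
          (s v ≠ u → s v ≠ v → c (s v) = b) := by
        by_cases a : s u ≠ u ∧ s u ≠ v
        · exact ⟨!(c (s u)), by simp, fun b1 b2 => Bool.eq_not_iff.mpr (h3 a.1 a.2 b1 b2)⟩
        · exact ⟨c (s v), fun b1 b2 => (a ⟨b1, b2⟩).elim, fun _ _ => rfl⟩
      refine ⟨fun x => if x = u then b else if x = v then !b else c x, fun x => ?_⟩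
      have h1x := h1 x
      have h2x := h2 x
      have hpx := hp x
      have hsx := hs x
      clear h1 h2 h3 hc hcard hp' hs' ih hp hs hn
      clear s' p'
      constructor
      · clear h2x hsx hsu hsv hb1 hb2
        grind
      · clear h1x hpx hpu hpv
        by_cases x1 : x = u
        · subst x1; grind
        by_cases x2 : x = v
        · subst x2; grind
        by_cases x3 : s x = u
        · have : s u = x := by rw [← x3, hsx]
          grind
        by_cases x4 : s x = v
        · have : s v = x := by rw [← x4, hsx]
          grind
        simpa [x1, x2, x3, x4] using h2x x1 x2 x3 x4

/-! ### Contests and their moves -/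

namespace Market

variable {V E : Type*} {M : Market V E}

/-- A state of unresolved competition. Every agent claims the bundle `top`; an agent `i` with
`mate i ≠ i` claims the same bundle as its mate and keeps `low i` as a fallback, for the case
that it has to leave `top i` to its mate. -/
structure IsContest (M : Market V E) (top low : V → Set E) (mate : V → V) : Prop where
  mate_mate : ∀ i, mate (mate i) = i
  top_mate : ∀ i, top (mate i) = top i
  low_eq : ∀ i, mate i = i → low i = top i
  top_rel : ∀ i, ∀ g ∈ top i, M.rel i g
  low_rel : ∀ i, ∀ g ∈ low i, M.rel i g
  top_parallel : ∀ i, M.Parallel (top i)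
  low_parallel : ∀ i, M.Parallel (low i)
  top_top : ∀ i j, j ≠ i → j ≠ mate i → Disjoint (top i) (top j)
  low_top : ∀ i j, mate i ≠ i → Disjoint (low i) (top j)
  -- A nonempty fallback can be shared by at most two agents, so sharing is a matching, which a
  -- colouring can separate.
  low_low : ∀ i j, mate i ≠ i → mate j ≠ j → low i = low j ∨ Disjoint (low i) (low j)
  top_le : ∀ i j, M.v i (top j) ≤ M.v i (top i)
  low_le : ∀ i j, M.v i (low j) ≤ M.v i (top i)
  -- Comparing with the fallback makes the bound survive whichever mate yields.
  top_efx : ∀ i j, ∀ g ∈ top j, M.v i (top j \ {g}) ≤ M.v i (low i)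
  low_efx : ∀ i j, ∀ g ∈ low j, M.v i (low j \ {g}) ≤ M.v i (low i)

namespace IsContest

theorem empty : IsContest M (fun _ => ∅) (fun _ => ∅) id where
  mate_mate _ := rfl
  top_mate _ := rfl
  low_eq _ _ := rfl
  top_rel _ _ h := h.elim
  low_rel _ _ h := h.elim
  top_parallel _ := Parallel.empty
  low_parallel _ := Parallel.empty
  top_top _ _ _ _ := Set.disjoint_empty _
  low_top _ _ _ := Set.disjoint_empty _
  low_low _ _ _ _ := Or.inl rfl
  top_le _ _ := le_rfl
  low_le _ _ := le_rfl
  top_efx _ _ _ h := h.elim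
  low_efx _ _ _ h := h.elim

variable {top low : V → Set E} {mate : V → V}

open Classical in
/-- A contested agent may replace its fallback. -/
theorem setLow (h : IsContest M top low mate) {i : V} (hi : mate i ≠ i) {Z : Set E}
    (hZrel : ∀ g ∈ Z, M.rel i g) (hZpar : M.Parallel Z) (hZtop : ∀ j, Disjoint Z (top j))
    (hZlow : ∀ j, mate j ≠ j → Z = low j ∨ Disjoint Z (low j))
    (hZle : ∀ k, M.v k Z ≤ M.v k (top k))
    (hZefx : ∀ k, ∀ g ∈ Z, M.v k (Z \ {g}) ≤ M.v k (low k))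
    (hup : M.v i (low i) ≤ M.v i Z) :
    IsContest M top (Function.update low i Z) mate := by
  have hmono : ∀ k, M.v k (low k) ≤ M.v k (Function.update low i Z k) := by
    intro k
    by_cases hk : k = i
    · subst hk; simpa using hup
    · simp [hk]
  refine ⟨h.mate_mate, h.top_mate, ?_, h.top_rel, ?_, h.top_parallel, ?_, h.top_top, ?_, ?_,
    h.top_le, ?_, fun k j g hg => (h.top_efx k j g hg).trans (hmono k), ?_⟩
  · intro k hk
    have : k ≠ i := by rintro rfl; exact hi hk
    simpa [this] using h.low_eq k hk
  · intro k
    by_cases hk : k = i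
    · subst hk; simpa using hZrel
    · simpa [hk] using h.low_rel k
  · intro k
    by_cases hk : k = i
    · subst hk; simpa using hZpar
    · simpa [hk] using h.low_parallel k
  · intro k j hkm
    by_cases hk : k = i
    · subst hk; simpa using hZtop j
    · simpa [hk] using h.low_top k j hkm
  · intro k j hkm hjm
    by_cases hk : k = i <;> by_cases hj : j = i
    · subst hk; subst hj; simp
    · subst hk; simpa [hj] using hZlow j hjm
    · subst hj
      simp only [Function.update_of_ne hk, Function.update_self]
      exact (hZlow k hkm).imp Eq.symm fun d => d.symm
    · simpa [hk, hj] using h.low_low k j hkm hjm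
  · intro k j
    by_cases hj : j = i
    · subst hj; simpa using hZle k
    · simpa [hj] using h.low_le k j
  · intro k j g hg
    refine le_trans ?_ (hmono k)
    by_cases hj : j = i
    · subst hj
      simp only [Function.update_self] at hg ⊢
      exact hZefx k g hg
    · simp only [Function.update_of_ne hj] at hg ⊢
      exact h.low_efx k j g hg

/-- Facts on a bundle `Z` taken from the pool. -/
structure Fresh (M : Market V E) (top low : V → Set E) (Z : Set E) : Prop where
  parallel : M.Parallel Z
  disj_top : ∀ j, Disjoint Z (top j)
  disj_low : ∀ j, Disjoint Z (low j)
  efx : ∀ k, ∀ g ∈ Z, M.v k (Z \ {g}) ≤ M.v k (low k)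

open Classical in
/-- An agent takes an uncontested new bundle; its former mate keeps their common claim. -/
theorem setTop (h : IsContest M top low mate) {i : V} {Z : Set E} (hZ : Fresh M top low Z)
    (hZrel : ∀ g ∈ Z, M.rel i g) (hZle : ∀ k, k ≠ i → M.v k Z ≤ M.v k (top k))
    (hup : M.v i (top i) ≤ M.v i Z) :
    IsContest M (fun a => if a = i then Z else top a)
      (fun a => if a = i then Z else if a = mate i then top a else low a)
      (fun a => if a = i ∨ a = mate i then a else mate a) := by
  have htop : ∀ k, M.v k (top k) ≤ M.v k (if k = i then Z else top k) := by
    intro k; split_ifs with hk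
    · subst hk; exact hup
    · exact le_rfl
  have hlow : ∀ k, M.v k (low k) ≤
      M.v k (if k = i then Z else if k = mate i then top k else low k) := by
    intro k; split_ifs with hk hk'
    · subst hk; exact (h.low_le k k).trans hup
    · exact h.low_le k k
    · exact le_rfl
  have hmm := h.mate_mate
  have htm := h.top_mate
  have hzt := hZ.disj_top
  have hzl := hZ.disj_low
  have htt := h.top_top
  have hlt := h.low_top
  have hll := h.low_low
  refine ⟨?_, ?_, ?_, ?_, ?_, ?_, ?_, ?_, ?_, ?_, ?_, ?_, ?_, ?_⟩
  · intro a; grind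
  · intro a; grind
  · intro a ha
    have := h.low_eq a
    grind
  · intro a; have := h.top_rel a; grind
  · intro a; have := h.low_rel a; have := h.top_rel a; grind
  · intro a; have := h.top_parallel a; have := hZ.parallel; grind
  · intro a; have := h.top_parallel a; have := h.low_parallel a; have := hZ.parallel; grind
  · intro a b; have := htt a b; have := hzt a; have := hzt b; grind [Disjoint.symm]
  · intro a b; have := hlt a b; have := hzl a; have := hzt b; grind [Disjoint.symm]
  · intro a b; have := hll a b; grind
  · intro k j
    by_cases hj : j = i
    · by_cases hk : k = i
      · simp [hj, hk]
      · simpa [hj, hk] using hZle k hk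
    · simpa [hj] using (h.top_le k j).trans (htop k)
  · intro k j
    by_cases hj : j = i
    · by_cases hk : k = i
      · simp [hj, hk]
      · simpa [hj, hk] using hZle k hk
    · refine le_trans ?_ (htop k)
      by_cases hj' : j = mate i
      · simpa [hj, if_pos hj'] using h.top_le k j
      · simpa [hj, hj'] using h.low_le k j
  · intro k j g hg
    refine le_trans ?_ (hlow k)
    by_cases hj : j = i
    · simp only [if_pos hj] at hg ⊢; exact hZ.efx k g hg
    · simp only [if_neg hj] at hg ⊢; exact h.top_efx k j g hg
  · intro k j g hg
    refine le_trans ?_ (hlow k)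
    by_cases hj : j = i
    · simp only [if_pos hj] at hg ⊢; exact hZ.efx k g hg
    · by_cases hj' : j = mate i
      · simp only [if_neg hj, if_pos hj'] at hg ⊢; exact h.top_efx k j g hg
      · simp only [if_neg hj, if_neg hj'] at hg ⊢; exact h.low_efx k j g hg

open Classical in
/-- Two agents become mates contesting a new bundle; former mates keep their claims. -/
theorem setMates (h : IsContest M top low mate) {i j : V} (hij : i ≠ j) {Z : Set E}
    (hZ : Fresh M top low Z)
    (hZi : ∀ g ∈ Z, M.rel i g) (hZj : ∀ g ∈ Z, M.rel j g)
    (hZle : ∀ k, k ≠ i → k ≠ j → M.v k Z ≤ M.v k (top k))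
    (hupi : M.v i (top i) ≤ M.v i Z) (hupj : M.v j (top j) ≤ M.v j Z) :
    IsContest M (fun a => if a = i ∨ a = j then Z else top a)
      (fun a => if a = i ∨ a = j then low a else if a = mate i ∨ a = mate j then top a else low a)
      (fun a => if a = i then j else if a = j then i else if a = mate i ∨ a = mate j then a
        else mate a) := by
  have htop : ∀ k, M.v k (top k) ≤ M.v k (if k = i ∨ k = j then Z else top k) := by
    intro k; split_ifs with hk
    · rcases hk with rfl | rfl
      · exact hupi
      · exact hupj
    · exact le_rfl
  have hlow : ∀ k, M.v k (low k) ≤ M.v k (if k = i ∨ k = j then low k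
      else if k = mate i ∨ k = mate j then top k else low k) := by
    intro k; split_ifs with hk hk'
    · exact le_rfl
    · exact h.low_le k k
    · exact le_rfl
  have hZle' : ∀ k, M.v k Z ≤ M.v k (if k = i ∨ k = j then Z else top k) := by
    intro k
    by_cases hk : k = i ∨ k = j
    · rw [if_pos hk]
    · rw [if_neg hk]; push Not at hk; exact hZle k hk.1 hk.2
  have hmm := h.mate_mate
  have htm := h.top_mate
  have hzt := hZ.disj_top
  have hzl := hZ.disj_low
  have htt := h.top_top
  have hlt := h.low_top
  have hll := h.low_low
  have hle := h.low_eq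
  refine ⟨?_, ?_, ?_, ?_, ?_, ?_, ?_, ?_, ?_, ?_, ?_, ?_, ?_, ?_⟩
  · intro a; grind
  · intro a; grind
  · intro a ha
    have := h.low_eq a
    grind
  · intro a; have := h.top_rel a; grind
  · intro a; have := h.low_rel a; have := h.top_rel a; grind
  · intro a; have := h.top_parallel a; have := hZ.parallel; grind
  · intro a; have := h.top_parallel a; have := h.low_parallel a; grind
  · intro a b; have := htt a b; have := hzt a; have := hzt b; grind [Disjoint.symm]
  · intro a b; have := hlt a b; have := htt a b; have := hzl a; have := hle a
    grind [Disjoint.symm]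
  · intro a b
    have := hll a b; have := htt a b; have := hle a; have := hle b
    have := hlt a b; have := hlt b a
    grind [Disjoint.symm]
  · intro k a
    by_cases ha : a = i ∨ a = j
    · simp only [if_pos ha]; exact hZle' k
    · simp only [if_neg ha]; exact (h.top_le k a).trans (htop k)
  · intro k a
    refine le_trans ?_ (htop k)
    split_ifs
    · exact h.low_le k a
    · exact h.top_le k a
    · exact h.low_le k a
  · intro k a g hg
    refine le_trans ?_ (hlow k)
    by_cases ha : a = i ∨ a = j
    · simp only [if_pos ha] at hg ⊢; exact hZ.efx k g hg
    · simp only [if_neg ha] at hg ⊢; exact h.top_efx k a g hg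
  · intro k a g hg
    refine le_trans ?_ (hlow k)
    by_cases ha : a = i ∨ a = j
    · simp only [if_pos ha] at hg ⊢; exact h.low_efx k a g hg
    · by_cases ha' : a = mate i ∨ a = mate j
      · simp only [if_neg ha, if_pos ha'] at hg ⊢; exact h.top_efx k a g hg
      · simp only [if_neg ha, if_neg ha'] at hg ⊢; exact h.low_efx k a g hg

/-! ### Maximal contests -/

variable (M) in
/-- There is a contest in which no Pareto improvement of claims and fallbacks is possible. -/
theorem exists_maximal [Finite V] [Finite E] : ∃ (top low : V → Set E) (mate : V → V),
    IsContest M top low mate ∧ ∀ top' low' mate', IsContest M top' low' mate' →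
      (∀ k, M.v k (top k) ≤ M.v k (top' k)) → (∀ k, M.v k (low k) ≤ M.v k (low' k)) →
      ∀ k, M.v k (top' k) ≤ M.v k (top k) ∧ M.v k (low' k) ≤ M.v k (low k) := by
  have := Fintype.ofFinite V
  obtain ⟨⟨top, low, mate⟩, h, hmax⟩ := Set.exists_max_image
    {s : (V → Set E) × (V → Set E) × (V → V) | IsContest M s.1 s.2.1 s.2.2}
    (fun s => ∑ k, (M.v k (s.1 k) + M.v k (s.2.1 k))) (Set.toFinite _)
    ⟨⟨fun _ => ∅, fun _ => ∅, id⟩, IsContest.empty⟩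
  refine ⟨top, low, mate, h, fun top' low' mate' h' ht hl => ?_⟩
  have h1 := hmax ⟨top', low', mate'⟩ h'
  have h2 : ∀ k ∈ Finset.univ, M.v k (top k) + M.v k (low k) ≤ M.v k (top' k) + M.v k (low' k) :=
    fun k _ => add_le_add (ht k) (hl k)
  have h3 := (Finset.sum_eq_sum_iff_of_le h2).1 (le_antisymm (Finset.sum_le_sum h2) h1)
  intro k
  have := h3 k (Finset.mem_univ k)
  constructor <;> linarith [ht k, hl k]

/-- The goods that are not claimed by anyone. -/
def pool (top low : V → Set E) : Set E := {g | ∀ k, g ∉ top k ∧ g ∉ low k}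

/-- In a maximal contest, nobody prefers the fallback of a contested agent to its own one, and
nobody prefers the unclaimed goods shared with another agent to its own fallback. -/
theorem exists_stable [Finite V] [Finite E] (M : Market V E) :
    ∃ (top low : V → Set E) (mate : V → V), IsContest M top low mate ∧
      (∀ i j, mate j ≠ j → M.v i (low j) ≤ M.v i (low i)) ∧
      ∀ i j, i ≠ j → M.v i (pool top low ∩ M.common i j) ≤ M.v i (low i) := by
  classical
  obtain ⟨top, low, mate, h, hmax⟩ := exists_maximal M
  refine ⟨top, low, mate, h, fun i j hj => ?_, fun i j hij => ?_⟩
  · by_contra! hlt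
    have hi : mate i ≠ i := by
      intro hi
      rw [h.low_eq i hi] at hlt
      exact (h.low_le i j).not_gt hlt
    -- An agent preferring `low j` could share it as its own fallback.
    have hc := h.setLow hi (Z := low j)
      ((h.low_parallel j).rel_of_lt (v_nonneg _ _) hlt) (h.low_parallel j)
      (fun k => h.low_top j k hj) (fun k hk => h.low_low j k hj hk) (fun k => h.low_le k j)
      (fun k => h.low_efx k j) hlt.le
    have := (hmax _ _ _ hc (fun _ => le_rfl) (fun k => ?_) i).2
    · rw [Function.update_self] at this
      exact this.not_gt hlt
    · by_cases hk : k = i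
      · subst hk; simpa using hlt.le
      · simp [hk]
  · by_contra! hlt
    -- Minimality makes `Z` EFX against the fallbacks. Depending on whether both, one or none of
    -- `i`, `j` prefer `Z` to their claims, it becomes a contested claim, an uncontested claim or a
    -- fallback; each contradicts maximality.
    obtain ⟨Z, hZ, hZlt, hZmin⟩ := exists_minimal_lt (j := j) (L := fun k => M.v k (low k)) hlt
    have hZc : Z ⊆ M.common i j := fun g hg => (hZ hg).2
    have hz0 : ∀ k, k ≠ i → k ≠ j → ∀ W ⊆ Z, M.v k W = 0 := by
      intro k hki hkj W hW
      refine v_eq_zero fun g hg hr => ?_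
      rcases M.rel_two g k i j hr (hZc (hW hg)).1 (hZc (hW hg)).2 with h1 | h1 | h1
      · exact hki h1
      · exact hkj h1
      · exact hij h1
    have hfresh : Fresh M top low Z := by
      refine ⟨parallel_of_common hij hZc, fun k => ?_, fun k => ?_, fun k g hg => ?_⟩
      · exact Set.disjoint_left.2 fun g hg => ((hZ hg).1 k).1
      · exact Set.disjoint_left.2 fun g hg => ((hZ hg).1 k).2
      · by_cases hki : k = i
        · subst hki; exact (hZmin g hg).1
        by_cases hkj : k = j
        · subst hkj; exact (hZmin g hg).2
        rw [hz0 k hki hkj _ Set.sdiff_subset]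
        exact v_nonneg _ _
    -- an agent takes `Z` as a new uncontested claim
    have key : ∀ a b, (∀ k, k ≠ a → k ≠ b → M.v k Z = 0) → (∀ g ∈ Z, M.rel a g) →
        M.v b Z ≤ M.v b (top b) → M.v a Z ≤ M.v a (top a) := by
      intro a b hab ha hb
      by_contra! hlt'
      have hc := h.setTop hfresh ha (fun k hk => ?_) hlt'.le
      · have := (hmax _ _ _ hc (fun k => ?_) (fun k => ?_) a).1
        · simp only [if_true] at this
          exact this.not_gt hlt'
        · by_cases hk : k = a
          · subst hk; simpa using hlt'.le
          · simp [hk]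
        · by_cases hk : k = a
          · subst hk; simpa using (h.low_le k k).trans hlt'.le
          · by_cases hk' : k = mate a
            · rw [if_neg hk, if_pos hk']; exact h.low_le k k
            · simp [hk, hk']
      · by_cases hkb : k = b
        · subst hkb; exact hb
        · rw [hab k hk hkb]; exact v_nonneg _ _
    -- an agent takes `Z` as a new fallback
    have key' : ∀ a, (∀ k, M.v k Z ≤ M.v k (top k)) → (∀ g ∈ Z, M.rel a g) →
        M.v a Z ≤ M.v a (low a) := by
      intro a hle ha
      by_contra! hlt'
      have hma : mate a ≠ a := by
        intro hma
        rw [h.low_eq a hma] at hlt'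
        exact (hle a).not_gt hlt'
      have hc := h.setLow hma ha hfresh.parallel hfresh.disj_top
        (fun k _ => Or.inr (hfresh.disj_low k)) hle hfresh.efx hlt'.le
      have := (hmax _ _ _ hc (fun _ => le_rfl) (fun k => ?_) a).2
      · rw [Function.update_self] at this
        exact this.not_gt hlt'
      · by_cases hk : k = a
        · subst hk; simpa using hlt'.le
        · simp [hk]
    have hZi : ∀ g ∈ Z, M.rel i g := fun g hg => (hZc hg).1
    have hZj : ∀ g ∈ Z, M.rel j g := fun g hg => (hZc hg).2
    by_cases hi : M.v i Z ≤ M.v i (top i)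
    · have hj := key j i (fun k h1 h2 => hz0 k h2 h1 Z subset_rfl) hZj hi
      have hall : ∀ k, M.v k Z ≤ M.v k (top k) := by
        intro k
        by_cases hki : k = i
        · subst hki; exact hi
        by_cases hkj : k = j
        · subst hkj; exact hj
        rw [hz0 k hki hkj Z subset_rfl]; exact v_nonneg _ _
      rcases hZlt with h1 | h1
      · exact (key' i hall hZi).not_gt h1
      · exact (key' j hall hZj).not_gt h1
    · have hj : ¬ M.v j Z ≤ M.v j (top j) := fun hj =>
        hi (key i j (fun k h1 h2 => hz0 k h1 h2 Z subset_rfl) hZi hj)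
      push Not at hi hj
      have hc := h.setMates hij hfresh hZi hZj (fun k h1 h2 => ?_) hi.le hj.le
      · have := (hmax _ _ _ hc (fun k => ?_) (fun k => ?_) i).1
        · simp only [true_or, if_true] at this
          exact this.not_gt hi
        · split_ifs with hk
          · rcases hk with rfl | rfl
            · exact hi.le
            · exact hj.le
          · exact le_rfl
        · split_ifs
          · exact le_rfl
          · exact h.low_le k k
          · exact le_rfl
      · rw [hz0 k h1 h2 Z subset_rfl]; exact v_nonneg _ _

end IsContest

/-! ### Resolving a contest into a partial allocation -/

/-- Disjoint bundles set aside, each relevant to its owner and at most one further agent. -/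
structure IsReserve (M : Market V E) (Q : V → Set E) : Prop where
  rel : ∀ i, ∀ g ∈ Q i, M.rel i g
  parallel : ∀ i, M.Parallel (Q i)
  disj : ∀ i j, i ≠ j → Disjoint (Q i) (Q j)

open Classical in
/-- A partial allocation `X` disjoint from the reserve `Q`, in which the agents of `ρ`, more than
`d` in number, are not envied. -/
structure IsConfig (M : Market V E) (d : ℕ) (Q : V → Set E) (ρ : Finset V) (X : V → Set E) :
    Prop where
  rel : ∀ i, ∀ g ∈ X i, M.rel i g
  disj : ∀ i j, i ≠ j → Disjoint (X i) (X j)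
  disj_res : ∀ i j, Disjoint (X i) (Q j)
  efx : ∀ i j, ∀ g ∈ X j, M.v i (X j \ {g}) ≤ M.v i (X i)
  root_le : ∀ i, ∀ j ∈ ρ, M.v i (X j) ≤ M.v i (X i)
  res_le : ∀ i j, M.v i (Q j) ≤ M.v i (X i)
  pool_le : ∀ i j, i ≠ j → M.v i (IsContest.pool X Q ∩ M.common i j) ≤ M.v i (X i)
  envier : ∀ i ∉ ρ, ∃ p ∈ ρ, p ≠ i ∧ ∀ g ∈ X i, M.rel p g
  card_lt : d + {i ∈ ρ | (Q i).Nonempty}.card < ρ.card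

namespace IsContest

variable {top low : V → Set E} {mate : V → V}

/-- Contested agents can be coloured such that mates, as well as agents with a common fallback,
get different colours. -/
theorem exists_coloring [Finite V] (h : IsContest M top low mate) :
    ∃ c : V → Bool, (∀ u, mate u ≠ u → c (mate u) ≠ c u) ∧
      ∀ u w, w ≠ u → mate u ≠ u → mate w ≠ w → (low u).Nonempty → low w = low u → c w ≠ c u := by
  classical
  let P : V → V → Prop := fun u w =>
    w ≠ u ∧ mate u ≠ u ∧ mate w ≠ w ∧ (low u).Nonempty ∧ low w = low u
  have huniq : ∀ u w w', P u w → P u w' → w = w' := by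
    rintro u w w' ⟨h1, _, _, ⟨g, hg⟩, h2⟩ ⟨h1', _, _, _, h2'⟩
    rcases M.rel_two g u w w' (h.low_rel _ g hg) (h.low_rel w g (h2 ▸ hg))
      (h.low_rel w' g (h2' ▸ hg)) with h3 | h3 | h3
    · exact (h1 h3.symm).elim
    · exact (h1' h3.symm).elim
    · exact h3
  have hsymm : ∀ u w, P u w → P w u := by
    rintro u w ⟨h1, h2, h3, h4, h5⟩
    exact ⟨h1.symm, h3, h2, h5 ▸ h4, h5.symm⟩
  let s : V → V := fun u => if hu : ∃ w, P u w then hu.choose else u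
  have hs1 : ∀ u w, P u w → s u = w := by
    intro u w hw
    have hu : ∃ w, P u w := ⟨w, hw⟩
    simp only [s, dif_pos hu]
    exact huniq u _ _ hu.choose_spec hw
  have hs : Function.Involutive s := by
    intro u
    by_cases hu : ∃ w, P u w
    · obtain ⟨w, hw⟩ := hu
      rw [hs1 u w hw, hs1 w u (hsymm u w hw)]
    · have : s u = u := by simp only [s, dif_neg hu]
      rw [this, this]
  obtain ⟨c, hc⟩ := exists_coloring_of_involutive h.mate_mate hs
  refine ⟨c, fun u => (hc u).1, fun u w h1 h2 h3 h4 h5 => ?_⟩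
  have := hs1 u w ⟨h1, h2, h3, h4, h5⟩
  have h6 := (hc u).2
  rw [this] at h6
  exact h6 h1

/-- The agents that may be envied when the contested agents of colour `true` leave the contested
claims to their mates. -/
def enviedSet (M : Market V E) (top low : V → Set E) (mate : V → V) (c : V → Bool) : Set V :=
  {i | (mate i ≠ i ∧ c i = false) ∨
    (mate i = i ∧ ∃ u, mate u ≠ u ∧ c u = true ∧ M.v u (low u) < M.v u (top i))}

open Classical in
/-- Resolve a stable contest along a colouring. -/
theorem exists_config_of_coloring [Fintype V] (h : IsContest M top low mate)
    (hlow : ∀ i j, mate j ≠ j → M.v i (low j) ≤ M.v i (low i))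
    (hpool : ∀ i j, i ≠ j → M.v i (pool top low ∩ M.common i j) ≤ M.v i (low i))
    {c : V → Bool} (hc1 : ∀ u, mate u ≠ u → c (mate u) ≠ c u)
    (hc2 : ∀ u w, w ≠ u → mate u ≠ u → mate w ≠ w → (low u).Nonempty → low w = low u →
      c w ≠ c u)
    {d : ℕ} (hd : d + (enviedSet M top low mate c).ncard < Fintype.card V) :
    ∃ Q ρ X, IsReserve M Q ∧ IsConfig M d Q ρ X := by
  let X : V → Set E := fun i => if mate i ≠ i ∧ c i = true then low i else top i
  -- Fallbacks of agents that win their claims, except those that a yielding agent receives as its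
  -- bundle.
  let Q : V → Set E := fun i => if mate i ≠ i ∧ c i = false ∧
    ∀ u, mate u ≠ u → c u = true → low u ≠ low i then low i else ∅
  have hXlow : ∀ i, mate i ≠ i → c i = true → X i = low i := fun i h1 h2 => if_pos ⟨h1, h2⟩
  have hXtop : ∀ i, ¬ (mate i ≠ i ∧ c i = true) → X i = top i := fun i h1 => if_neg h1
  have hQlow : ∀ i g, g ∈ Q i → Q i = low i ∧ mate i ≠ i ∧ c i = false ∧
      ∀ u, mate u ≠ u → c u = true → low u ≠ low i := by
    intro i g hg
    by_cases hi : mate i ≠ i ∧ c i = false ∧ ∀ u, mate u ≠ u → c u = true → low u ≠ low i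
    · exact ⟨if_pos hi, hi⟩
    · simp only [Q, if_neg hi] at hg; exact hg.elim
  have hlev : ∀ i, M.v i (low i) ≤ M.v i (X i) := by
    intro i
    simp only [X]; split_ifs
    · exact le_rfl
    · exact h.low_le i i
  have hll : ∀ i j, i ≠ j → mate i ≠ i → mate j ≠ j → c i = c j → Disjoint (low i) (low j) := by
    intro i j hij hi hj hcij
    rcases h.low_low i j hi hj with h1 | h1
    · by_cases hne : (low i).Nonempty
      · exact (hc2 i j hij.symm hi hj hne h1.symm hcij.symm).elim
      · rw [Set.not_nonempty_iff_eq_empty.1 hne]; exact Set.empty_disjoint _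
    · exact h1
  have hres : IsReserve M Q := by
    refine ⟨fun i g hg => ?_, fun i g hg => ?_, fun i j hij => ?_⟩
    · have := (hQlow i g hg).1
      exact h.low_rel i g (this ▸ hg)
    · rw [(hQlow i g hg).1]
      exact h.low_parallel i g ((hQlow i g hg).1 ▸ hg)
    · refine Set.disjoint_left.2 fun g hg hg' => ?_
      obtain ⟨a1, a2, a3, a4⟩ := hQlow i g hg
      obtain ⟨b1, b2, b3, b4⟩ := hQlow j g hg'
      rw [a1] at hg; rw [b1] at hg'
      exact Set.disjoint_left.1 (hll i j hij a2 b2 (a3.trans b3.symm)) hg hg'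
  have hsub : pool X Q ⊆ pool top low := by
    intro g hg k
    have hk := hg k
    have hktop : g ∉ top k := by
      by_cases hkc : mate k ≠ k ∧ c k = true
      · have h1 := (hg (mate k)).1
        rw [hXtop, h.top_mate] at h1
        · exact h1
        · rintro ⟨_, h2⟩
          exact hc1 k hkc.1 (h2.trans hkc.2.symm)
      · rw [hXtop k hkc] at hk; exact hk.1
    refine ⟨hktop, ?_⟩
    by_cases hkm : mate k = k
    · rw [h.low_eq k hkm]; exact hktop
    by_cases hkc : c k = true
    · rw [hXlow k hkm hkc] at hk; exact hk.1
    by_cases hsh : ∀ u, mate u ≠ u → c u = true → low u ≠ low k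
    · have : Q k = low k := if_pos ⟨hkm, by simpa using hkc, hsh⟩
      rw [this] at hk; exact hk.2
    · push Not at hsh
      obtain ⟨u, hu, hcu, hlu⟩ := hsh
      have h1 := (hg u).1
      rwa [hXlow u hu hcu, hlu] at h1
  refine ⟨Q, Finset.univ.filter (fun i => i ∉ enviedSet M top low mate c), X, hres,
    ⟨fun i => ?_, fun i j hij => ?_, fun i j => ?_, fun i j g hg => ?_, fun i j hj => ?_,
      fun i j => ?_, fun i j hij => ?_, fun i hi => ?_, ?_⟩⟩
  · simp only [X]; split_ifs
    · exact h.low_rel i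
    · exact h.top_rel i
  · by_cases hi : mate i ≠ i ∧ c i = true <;> by_cases hj : mate j ≠ j ∧ c j = true
    · rw [hXlow i hi.1 hi.2, hXlow j hj.1 hj.2]
      exact hll i j hij hi.1 hj.1 (hi.2.trans hj.2.symm)
    · rw [hXlow i hi.1 hi.2, hXtop j hj]; exact h.low_top i j hi.1
    · rw [hXlow j hj.1 hj.2, hXtop i hi]; exact (h.low_top j i hj.1).symm
    · rw [hXtop i hi, hXtop j hj]
      refine h.top_top i j hij.symm ?_
      rintro rfl
      have h1 := hc1 i hij.symm
      rw [h.mate_mate] at hj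
      cases hci : c i
      · cases hcm : c (mate i)
        · exact h1 (hcm.trans hci.symm)
        · exact hj ⟨hij, hcm⟩
      · exact hi ⟨hij.symm, hci⟩
  · refine Set.disjoint_left.2 fun g hg hg' => ?_
    obtain ⟨b1, b2, b3, b4⟩ := hQlow j g hg'
    rw [b1] at hg'
    by_cases hi : mate i ≠ i ∧ c i = true
    · rw [hXlow i hi.1 hi.2] at hg
      rcases h.low_low i j hi.1 b2 with h1 | h1
      · exact b4 i hi.1 hi.2 h1
      · exact Set.disjoint_left.1 h1 hg hg'
    · rw [hXtop i hi] at hg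
      exact Set.disjoint_left.1 (h.low_top j i b2) hg' hg
  · refine le_trans ?_ (hlev i)
    by_cases hj : mate j ≠ j ∧ c j = true
    · rw [hXlow j hj.1 hj.2] at hg ⊢; exact h.low_efx i j g hg
    · rw [hXtop j hj] at hg ⊢; exact h.top_efx i j g hg
  · simp only [Finset.mem_filter, Finset.mem_univ, true_and, enviedSet, Set.mem_ofPred_eq,
      not_or, not_and, not_exists] at hj
    by_cases hjl : mate j ≠ j ∧ c j = true
    · rw [hXlow j hjl.1 hjl.2]
      exact (hlow i j hjl.1).trans (hlev i)
    · rw [hXtop j hjl]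
      have hjn : mate j = j := by
        by_contra hjn
        exact hjl ⟨hjn, by simpa using hj.1 hjn⟩
      by_cases hi : mate i ≠ i ∧ c i = true
      · rw [hXlow i hi.1 hi.2]
        exact not_lt.1 (hj.2 hjn i hi.1 hi.2)
      · rw [hXtop i hi]; exact h.top_le i j
  · simp only [Q]
    split_ifs with hj
    · exact (hlow i j hj.1).trans (hlev i)
    · rw [M.v_empty]; exact v_nonneg _ _
  · exact (v_mono (Set.inter_subset_inter_left _ hsub)).trans ((hpool i j hij).trans (hlev i))
  · simp only [Finset.mem_filter, Finset.mem_univ, true_and, not_not] at hi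
    have hroot : ∀ u, mate u ≠ u → c u = true → u ∉ enviedSet M top low mate c := by
      rintro u hu hcu (⟨_, h2⟩ | ⟨h2, _⟩)
      · rw [hcu] at h2; exact Bool.noConfusion h2
      · exact hu h2
    rcases hi with ⟨hi, hci⟩ | ⟨hi, u, hu, hcu, hlt⟩
    · have hcm : c (mate i) = true := by
        have := hc1 i hi
        rw [hci] at this
        simpa using this
      refine ⟨mate i, ?_, hi, ?_⟩
      · simp only [Finset.mem_filter, Finset.mem_univ, true_and]
        refine hroot _ ?_ hcm
        rw [h.mate_mate]; exact hi.symm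
      · rw [hXtop i (by simp [hci]), ← h.top_mate]
        exact h.top_rel (mate i)
    · refine ⟨u, ?_, fun hui => hu (hui ▸ hi), ?_⟩
      · simp only [Finset.mem_filter, Finset.mem_univ, true_and]
        exact hroot u hu hcu
      · rw [hXtop i (by simp [hi])]
        exact (h.top_parallel i).rel_of_lt (v_nonneg _ _) hlt
  -- Owners of reserved bundles are winners of contests, hence not roots.
  · have h0 : ({i ∈ Finset.univ.filter (fun i => i ∉ enviedSet M top low mate c) |
        (Q i).Nonempty}) = ∅ := by
      refine Finset.filter_eq_empty_iff.2 fun i hi hne => ?_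
      obtain ⟨g, hg⟩ := hne
      obtain ⟨_, h1, h2, _⟩ := hQlow i g hg
      simp only [Finset.mem_filter, Finset.mem_univ, true_and] at hi
      exact hi (Or.inl ⟨h1, h2⟩)
    rw [h0, Finset.card_empty, add_zero]
    have h1 := Finset.card_filter_add_card_filter_not (s := (Finset.univ : Finset V))
      (fun i => i ∈ enviedSet M top low mate c)
    have h2 : (enviedSet M top low mate c).ncard =
        (Finset.univ.filter (fun i => i ∈ enviedSet M top low mate c)).card := by
      rw [← Set.ncard_coe_finset]; simp
    rw [Finset.card_univ] at h1
    omega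

/-- Reversing the colours exchanges winners and losers of contests. An uncontested claim interests
at most one agent besides its owner, and that agent yields under only one of the two colourings. -/
theorem disjoint_enviedSet (h : IsContest M top low mate) (c : V → Bool) :
    Disjoint (enviedSet M top low mate c) (enviedSet M top low mate (fun i => !(c i))) := by
  refine Set.disjoint_left.2 ?_
  rintro i (⟨h1, h2⟩ | ⟨h1, u, hu, hcu, hlt⟩) (⟨h1', h2'⟩ | ⟨h1', u', hu', hcu', hlt'⟩)
  · simp [h2] at h2'
  · exact h1 h1'
  · exact h1' h1
  · obtain ⟨g, hg, hr⟩ := exists_rel_of_lt (v_nonneg _ _) hlt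
    have hr' := (h.top_parallel i).rel_of_lt (v_nonneg _ _) hlt' g hg
    rcases M.rel_two g i u u' (h.top_rel i g hg) hr hr' with h3 | h3 | h3
    · exact hu (h3 ▸ h1)
    · exact hu' (h3 ▸ h1)
    · subst h3; simp [hcu] at hcu'

end IsContest

/-- The better of a colouring and its reverse leaves at least half of the agents unenvied, which is
more than `d`. -/
theorem exists_config [Fintype V] [Finite E] (M : Market V E) {d : ℕ}
    (hd : 2 * d < Fintype.card V) : ∃ Q ρ X, IsReserve M Q ∧ IsConfig M d Q ρ X := by
  obtain ⟨top, low, mate, h, hlow, hpool⟩ := IsContest.exists_stable M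
  obtain ⟨c, hc1, hc2⟩ := h.exists_coloring
  have hcard := (Set.ncard_union_eq (h.disjoint_enviedSet c)).symm.trans_le
    (Set.ncard_le_card _)
  rw [Nat.card_eq_fintype_card] at hcard
  by_cases hle : (IsContest.enviedSet M top low mate c).ncard ≤
      (IsContest.enviedSet M top low mate (fun i => !(c i))).ncard
  · exact h.exists_config_of_coloring hlow hpool hc1 hc2 (by omega)
  · refine h.exists_config_of_coloring hlow hpool (c := fun i => !(c i)) ?_ ?_ (by omega)
    · intro u hu; simpa using hc1 u hu
    · intro u w a1 a2 a3 a4 a5; simpa using hc2 u w a1 a2 a3 a4 a5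

/-! ### Improving a configuration until nobody prefers the pool -/

namespace IsConfig

open IsContest (pool)

variable {d : ℕ} {Q : V → Set E} {ρ : Finset V} {X : V → Set E}

/-- The unallocated goods relevant to `i`. -/
def want (M : Market V E) (Q X : V → Set E) (i : V) : Set E := {g | g ∈ pool X Q ∧ M.rel i g}

theorem le_want (i : V) : M.v i (pool X Q) ≤ M.v i (want M Q X i) :=
  M.v_le i _ (want M Q X i) fun _ hg hr => ⟨hg, hr⟩

/-- Another agent `a` sees in this bundle only pool goods shared with `i`, which `pool_le` bounds.
-/
theorem want_le (h : IsConfig M d Q ρ X) {a i : V} (hai : a ≠ i) :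
    M.v a (want M Q X i) ≤ M.v a (X a) :=
  (M.v_le a _ (pool X Q ∩ M.common a i) fun _ hg hr => ⟨hg.1, hr, hg.2⟩).trans (h.pool_le a i hai)

/-- The new root may own a reserved bundle, but then both sides grow by one. -/
theorem card_insert_lt [DecidableEq V] (h : IsConfig M d Q ρ X) {i : V} (hi : i ∉ ρ)
    [DecidablePred fun j => (Q j).Nonempty] :
    d + {j ∈ insert i ρ | (Q j).Nonempty}.card < (insert i ρ).card := by
  have h1 := h.card_lt
  have h2 : {j ∈ insert i ρ | (Q j).Nonempty}.card ≤ {j ∈ ρ | (Q j).Nonempty}.card + 1 := by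
    rw [Finset.filter_insert]
    split_ifs
    · exact Finset.card_insert_le _ _
    · omega
  rw [Finset.card_insert_of_notMem hi]
  have h3 : {j ∈ ρ | (Q j).Nonempty}.card =
    (@Finset.filter _ (fun j => (Q j).Nonempty) (fun _ => Classical.propDecidable _) ρ).card := by
    congr
  omega

open Classical in
/-- An unenvied agent swaps its bundle for the unallocated goods. -/
theorem swap (h : IsConfig M d Q ρ X) {i : V} (hi : i ∈ ρ)
    (hlt : M.v i (X i) < M.v i (pool X Q)) :
    IsConfig M d Q ρ (Function.update X i (want M Q X i)) := by
  have hup : ∀ a, M.v a (X a) ≤ M.v a (Function.update X i (want M Q X i) a) := by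
    intro a
    by_cases ha : a = i
    · subst ha; simpa using hlt.le.trans (le_want _)
    · simp [ha]
  have hroot : ∀ a, M.v a (want M Q X i) ≤ M.v a (Function.update X i (want M Q X i) a) := by
    intro a
    by_cases ha : a = i
    · subst ha; simp
    · exact (h.want_le ha).trans (hup a)
  refine ⟨fun a => ?_, fun a b hab => ?_, fun a b => ?_, fun a b g hg => ?_, fun a b hb => ?_,
    fun a b => (h.res_le a b).trans (hup a), fun a b hab => ?_, fun a ha => ?_, h.card_lt⟩
  · by_cases ha : a = i
    · subst ha; simpa using fun g (hg : g ∈ want M Q X a) => hg.2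
    · simpa [ha] using h.rel a
  · have hw : ∀ k, Disjoint (want M Q X i) (X k) := fun k =>
      Set.disjoint_left.2 fun g hg => (hg.1 k).1
    by_cases ha : a = i <;> by_cases hb : b = i
    · exact (hab (ha.trans hb.symm)).elim
    · simpa [ha, hb] using hw b
    · simpa [ha, hb] using (hw a).symm
    · simpa [ha, hb] using h.disj a b hab
  · by_cases ha : a = i
    · subst ha
      rw [Function.update_self]
      exact Set.disjoint_left.2 fun g hg => (hg.1 b).2
    · simpa [ha] using h.disj_res a b
  · by_cases hb : b = i
    · subst hb
      rw [Function.update_self]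
      exact (v_mono Set.sdiff_subset).trans (hroot a)
    · rw [Function.update_of_ne hb] at hg ⊢
      exact (h.efx a b g hg).trans (hup a)
  · by_cases hbi : b = i
    · subst hbi
      rw [Function.update_self]
      exact hroot a
    · rw [Function.update_of_ne hbi]
      exact (h.root_le a b hb).trans (hup a)
  · refine le_trans ?_ (hup a)
    -- The pool loses all its goods relevant to `i` and gains at most `X i`, which nobody envies
    -- since `i` is a root.
    have hsub : ∀ g ∈ pool (Function.update X i (want M Q X i)) Q,
        (g ∈ pool X Q ∧ ¬ M.rel i g) ∨ g ∈ X i := by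
      intro g hg
      by_cases hgi : g ∈ X i
      · exact Or.inr hgi
      · have hp : g ∈ pool X Q := by
          intro k
          refine ⟨?_, (hg k).2⟩
          by_cases hk : k = i
          · subst hk; exact hgi
          · simpa [hk] using (hg k).1
        refine Or.inl ⟨hp, fun hr => ?_⟩
        have := (hg i).1
        rw [Function.update_self] at this
        exact this ⟨hp, hr⟩
    by_cases hai : a = i ∨ b = i
    · refine le_trans (v_mono (T := X i) ?_) (h.root_le a i hi)
      rintro g ⟨hg, hr⟩
      rcases hsub g hg with h1 | h1
      · rcases hai with rfl | rfl
        · exact (h1.2 hr.1).elim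
        · exact (h1.2 hr.2).elim
      · exact h1
    · push Not at hai
      refine le_trans (v_mono ?_) (h.pool_le a b hab)
      rintro g ⟨hg, hr⟩
      rcases hsub g hg with h1 | h1
      · exact ⟨h1.1, hr⟩
      · rcases M.rel_two g a b i hr.1 hr.2 (h.rel i g h1) with h2 | h2 | h2
        · exact (hab h2).elim
        · exact (hai.1 h2).elim
        · exact (hai.2 h2).elim
  · obtain ⟨p, hp, hpa, hpr⟩ := h.envier a ha
    have hai : a ≠ i := by rintro rfl; exact ha hi
    exact ⟨p, hp, hpa, by simpa [hai] using hpr⟩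

/-- The owner `i` and the agent `p` already exhaust the agents interested in `X i`. -/
theorem v_eq_zero_of_envier (h : IsConfig M d Q ρ X) {i p a : V} (hpi : p ≠ i)
    (hpr : ∀ g ∈ X i, M.rel p g) (hai : a ≠ i) (hap : a ≠ p) : ∀ g ∈ X i, ¬ M.rel a g := by
  intro g hg hr
  rcases M.rel_two g a i p hr (h.rel i g hg) (hpr g hg) with h1 | h1 | h1
  · exact hai h1
  · exact hap h1
  · exact hpi h1.symm

open Classical in
/-- An agent that is not envied can be counted as such. -/
theorem insert_root (h : IsConfig M d Q ρ X) {i p : V} (hi : i ∉ ρ) (hpi : p ≠ i)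
    (hpr : ∀ g ∈ X i, M.rel p g) (hle : M.v p (X i) ≤ M.v p (X p)) :
    IsConfig M d Q (insert i ρ) X := by
  refine ⟨h.rel, h.disj, h.disj_res, h.efx, fun a b hb => ?_, h.res_le, h.pool_le,
    fun a ha => ?_, h.card_insert_lt hi⟩
  · rcases Finset.mem_insert.1 hb with rfl | hb
    · by_cases hap : a = p
      · subst hap; exact hle
      by_cases hab : a = b
      · subst hab; exact le_rfl
      rw [v_eq_zero (h.v_eq_zero_of_envier hpi hpr hab hap)]
      exact v_nonneg _ _
    · exact h.root_le a b hb
  · rw [Finset.mem_insert, not_or] at ha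
    obtain ⟨q, hq, h1⟩ := h.envier a ha.2
    exact ⟨q, Finset.mem_insert_of_mem hq, h1⟩

open Classical in
/-- An envied agent takes the unallocated goods and leaves its bundle to the agent envying it. -/
theorem release (h : IsConfig M d Q ρ X) {i p : V} (hi : i ∉ ρ) (hp : p ∈ ρ) (hpi : p ≠ i)
    (hpr : ∀ g ∈ X i, M.rel p g) (hpl : M.v p (X p) < M.v p (X i))
    (hlt : M.v i (X i) < M.v i (pool X Q)) :
    IsConfig M d Q (insert i ρ) (fun a => if a = i then want M Q X i else
      if a = p then X i ∪ {g | g ∈ X p ∧ ¬ M.rel i g} else X a) := by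
  obtain ⟨Y, hY⟩ : ∃ Y : V → Set E, Y = (fun a => if a = i then want M Q X i else
      if a = p then X i ∪ {g | g ∈ X p ∧ ¬ M.rel i g} else X a) := ⟨_, rfl⟩
  rw [← hY]
  have hYi : Y i = want M Q X i := by simp [hY]
  have hYp : Y p = X i ∪ {g | g ∈ X p ∧ ¬ M.rel i g} := by simp [hY, hpi]
  have hYa : ∀ a, a ≠ i → a ≠ p → Y a = X a := by intro a h1 h2; simp [hY, h1, h2]
  have hup : ∀ a, M.v a (X a) ≤ M.v a (Y a) := by
    intro a
    by_cases ha : a = i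
    · subst ha; rw [hYi]; exact hlt.le.trans (le_want _)
    by_cases ha' : a = p
    · subst ha'; rw [hYp]; exact hpl.le.trans (v_mono Set.subset_union_left)
    rw [hYa a ha ha']
  have hri : ∀ a, M.v a (Y i) ≤ M.v a (Y a) := by
    intro a
    by_cases ha : a = i
    · subst ha; exact le_rfl
    · rw [hYi]; exact (h.want_le ha).trans (hup a)
  have hrp : ∀ a, M.v a (Y p) ≤ M.v a (Y a) := by
    intro a
    by_cases ha' : a = p
    · subst ha'; exact le_rfl
    refine le_trans ?_ (hup a)
    rw [hYp]
    by_cases ha : a = i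
    · subst ha
      refine M.v_le _ _ _ ?_
      rintro g (hg | hg) hr
      · exact hg
      · exact (hg.2 hr).elim
    · refine le_trans (M.v_le _ _ (X p) ?_) (h.root_le a p hp)
      rintro g (hg | hg) hr
      · exact (h.v_eq_zero_of_envier hpi hpr ha ha' g hg hr).elim
      · exact hg.1
  have hw : ∀ k, Disjoint (want M Q X i) (X k) := fun k =>
    Set.disjoint_left.2 fun g hg => (hg.1 k).1
  have hsubp : Y p ⊆ X i ∪ X p := by
    rw [hYp]; exact Set.union_subset_union_right _ fun g hg => hg.1
  have hdi : ∀ b, b ≠ i → Disjoint (Y i) (Y b) := by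
    intro b hb
    rw [hYi]
    by_cases hbp : b = p
    · subst hbp
      exact ((hw i).union_right (hw b)).mono_right hsubp
    · rw [hYa b hb hbp]; exact hw b
  have hdp : ∀ b, b ≠ i → b ≠ p → Disjoint (Y p) (Y b) := by
    intro b hb hbp
    rw [hYa b hb hbp]
    exact ((h.disj i b hb.symm).union_left (h.disj p b hbp.symm)).mono_left hsubp
  refine ⟨fun a => ?_, fun a b hab => ?_, fun a b => ?_, fun a b g hg => ?_, fun a b hb => ?_,
    fun a b => (h.res_le a b).trans (hup a), fun a b hab => ?_, fun a ha => ?_,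
    h.card_insert_lt hi⟩
  · by_cases ha : a = i
    · subst ha; rw [hYi]; exact fun g hg => hg.2
    by_cases ha' : a = p
    · subst ha'
      intro g hg
      rcases hsubp hg with h1 | h1
      · exact hpr g h1
      · exact h.rel a g h1
    rw [hYa a ha ha']; exact h.rel a
  · by_cases ha : a = i
    · subst ha; exact hdi b hab.symm
    by_cases hb : b = i
    · subst hb; exact (hdi a hab).symm
    by_cases hap : a = p
    · subst hap; exact hdp b hb hab.symm
    by_cases hbp : b = p
    · subst hbp; exact (hdp a ha hab).symm
    rw [hYa a ha hap, hYa b hb hbp]; exact h.disj a b hab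
  · by_cases ha : a = i
    · subst ha
      rw [hYi]
      exact Set.disjoint_left.2 fun g hg => (hg.1 b).2
    by_cases ha' : a = p
    · subst ha'
      exact ((h.disj_res i b).union_left (h.disj_res a b)).mono_left hsubp
    rw [hYa a ha ha']; exact h.disj_res a b
  · by_cases hbi : b = i
    · subst hbi; exact (v_mono Set.sdiff_subset).trans (hri a)
    by_cases hbp : b = p
    · subst hbp; exact (v_mono Set.sdiff_subset).trans (hrp a)
    rw [hYa b hbi hbp] at hg ⊢
    exact (h.efx a b g hg).trans (hup a)
  · by_cases hbi : b = i
    · subst hbi; exact hri a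
    by_cases hbp : b = p
    · subst hbp; exact hrp a
    rw [hYa b hbi hbp]
    exact (h.root_le a b (Finset.mem_of_mem_insert_of_ne hb hbi)).trans (hup a)
  · refine le_trans ?_ (hup a)
    -- Since `p` keeps what is irrelevant to `i`, the goods freed are shared by `p` and `i` and lie
    -- in the unenvied bundle `X p`.
    have hsub : ∀ g ∈ pool Y Q, (g ∈ pool X Q ∧ ¬ M.rel i g) ∨ (g ∈ X p ∧ M.rel i g) := by
      intro g hg
      have h1 := (hg p).1
      rw [hYp] at h1
      by_cases hgp : g ∈ X p
      · refine Or.inr ⟨hgp, ?_⟩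
        by_contra hr
        exact h1 (Or.inr ⟨hgp, hr⟩)
      · have hp : g ∈ pool X Q := by
          intro k
          refine ⟨?_, (hg k).2⟩
          by_cases hk : k = i
          · subst hk; exact fun h2 => h1 (Or.inl h2)
          by_cases hk' : k = p
          · subst hk'; exact hgp
          rw [← hYa k hk hk']; exact (hg k).1
        refine Or.inl ⟨hp, fun hr => ?_⟩
        have := (hg i).1
        rw [hYi] at this
        exact this ⟨hp, hr⟩
    by_cases hai : a = i ∨ b = i
    · refine le_trans (v_mono (T := X p) ?_) (h.root_le a p hp)
      rintro g ⟨hg, hr⟩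
      rcases hsub g hg with h1 | h1
      · rcases hai with rfl | rfl
        · exact (h1.2 hr.1).elim
        · exact (h1.2 hr.2).elim
      · exact h1.1
    · push Not at hai
      refine le_trans (v_mono ?_) (h.pool_le a b hab)
      rintro g ⟨hg, hr⟩
      rcases hsub g hg with h1 | h1
      · exact ⟨h1.1, hr⟩
      · rcases M.rel_two g a b i hr.1 hr.2 h1.2 with h2 | h2 | h2
        · exact (hab h2).elim
        · exact (hai.1 h2).elim
        · exact (hai.2 h2).elim
  · rw [Finset.mem_insert, not_or] at ha
    obtain ⟨q, hq, hqa, h1⟩ := h.envier a ha.2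
    refine ⟨q, Finset.mem_insert_of_mem hq, hqa, ?_⟩
    rw [hYa a ha.1 (by rintro rfl; exact ha.2 hp)]
    exact h1

/-- A configuration can be chosen such that nobody prefers the unallocated goods. -/
theorem exists_pool_le [Finite V] [Finite E] (h : IsConfig M d Q ρ X) :
    ∃ ρ X, IsConfig M d Q ρ X ∧ ∀ i, M.v i (pool X Q) ≤ M.v i (X i) := by
  classical
  have := Fintype.ofFinite V
  -- A swap raises the total value for the same roots; the other two moves add a root.
  obtain ⟨⟨ρ, X⟩, h, hmax⟩ := Set.exists_max_image
    {s : Finset V × (V → Set E) | IsConfig M d Q s.1 s.2}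
    (fun s => toLex (s.1.card, ∑ k, M.v k (s.2 k))) (Set.toFinite _) ⟨⟨ρ, X⟩, h⟩
  have hcard : ∀ i Y, i ∉ ρ → ¬ IsConfig M d Q (insert i ρ) Y := by
    intro i Y hi hY
    have h1 := hmax ⟨insert i ρ, Y⟩ hY
    rw [Prod.Lex.toLex_le_toLex] at h1
    simp only [Finset.card_insert_of_notMem hi] at h1
    omega
  refine ⟨ρ, X, h, fun i => ?_⟩
  by_contra! hlt
  by_cases hi : i ∈ ρ
  · have h1 := hmax ⟨ρ, Function.update X i (want M Q X i)⟩ (h.swap hi hlt)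
    rw [Prod.Lex.toLex_le_toLex] at h1
    have h2 : ∑ k, M.v k (X k) < ∑ k, M.v k (Function.update X i (want M Q X i) k) := by
      refine Finset.sum_lt_sum (fun k _ => ?_) ⟨i, Finset.mem_univ i, ?_⟩
      · by_cases hk : k = i
        · subst hk; simpa using hlt.le.trans (le_want _)
        · simp [hk]
      · simpa using hlt.trans_le (le_want _)
    rcases h1 with h1 | h1
    · exact lt_irrefl _ h1
    · exact h1.2.not_gt h2
  · obtain ⟨p, hp, hpi, hpr⟩ := h.envier i hi
    rcases le_or_gt (M.v p (X i)) (M.v p (X p)) with hle | hpl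
    · exact hcard i _ hi (h.insert_root hi hpi hpr hle)
    · exact hcard i _ hi (h.release hi hp hpi hpr hpl hlt)

end IsConfig

/-! ### Handing out the reserve and the pool -/

open IsContest (pool)

/-- The agents of `ρ` that must not receive the good `g`, since an agent interested in `g` would
then be interested in other goods of the bundle as well. -/
def blocked (M : Market V E) (ρ : Finset V) (X : V → Set E) (g : E) : Set V :=
  {k | k ∈ ρ ∧ ∃ a, M.rel a g ∧ (k = a ∨ ∃ e ∈ X k, M.rel a e)}

/-- The owners of reserved bundles containing goods relevant to an agent interested in `g`. -/
def touching (M : Market V E) (Q : V → Set E) (g : E) : Set V :=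
  {i | ∃ a, M.rel a g ∧ ∃ e ∈ Q i, M.rel a e}

/-- A partial EFX allocation with a reserve and with enough unenvied agents to hand out the
reserve and the unallocated goods. -/
structure IsSpread (M : Market V E) (Q : V → Set E) (ρ : Finset V) (X : V → Set E) : Prop where
  reserve : IsReserve M Q
  disj : ∀ i j, i ≠ j → Disjoint (X i) (X j)
  disj_res : ∀ i j, Disjoint (X i) (Q j)
  efx : ∀ i j, ∀ g ∈ X j, M.v i (X j \ {g}) ≤ M.v i (X i)
  root_le : ∀ i, ∀ j ∈ ρ, M.v i (X j) ≤ M.v i (X i)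
  res_le : ∀ i j, M.v i (Q j) ≤ M.v i (X i)
  pool_le : ∀ i, M.v i (pool X Q) ≤ M.v i (X i)
  card_lt : ∀ g, (blocked M ρ X g).ncard + (touching M Q g).ncard < ρ.card

namespace IsSpread

variable {Q : V → Set E} {ρ : Finset V} {X : V → Set E}

theorem exists_not_blocked (h : IsSpread M Q ρ X) (g : E) : ∃ k ∈ ρ, k ∉ blocked M ρ X g := by
  by_contra! hc
  have h1 : (ρ : Set V) ⊆ blocked M ρ X g := fun k hk => hc k hk
  have h2 := Set.ncard_le_ncard h1 (ρ.finite_toSet.subset fun k hk => hk.1)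
  rw [Set.ncard_coe_finset] at h2
  have := h.card_lt g
  omega

open Classical in
/-- Hand out one of the reserved bundles. -/
theorem give [Finite V] (h : IsSpread M Q ρ X) {i k : V} {e : E} (he : e ∈ Q i) (hk : k ∈ ρ)
    (hkb : k ∉ blocked M ρ X e) :
    IsSpread M (Function.update Q i ∅) ρ (Function.update X k (X k ∪ Q i)) := by
  have hkb' : ∀ a, M.rel a e → k ≠ a ∧ ∀ g ∈ X k, ¬ M.rel a g := by
    intro a ha
    exact ⟨fun h1 => hkb ⟨hk, a, ha, Or.inl h1⟩, fun g hg hr => hkb ⟨hk, a, ha, Or.inr ⟨g, hg, hr⟩⟩⟩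
  have hup : ∀ a, M.v a (X a) ≤ M.v a (Function.update X k (X k ∪ Q i) a) := by
    intro a
    by_cases ha : a = k
    · subst ha; simpa using v_mono Set.subset_union_left
    · simp [ha]
  have hroot : ∀ a, M.v a (X k ∪ Q i) ≤ M.v a (Function.update X k (X k ∪ Q i) a) := by
    intro a
    by_cases ha : a = k
    · subst ha; simp
    refine le_trans ?_ (hup a)
    -- An agent interested in `e` sees nothing of `X k`; any other agent sees nothing of `Q i`,
    -- whose goods all interest the same agents.
    by_cases hr : M.rel a e
    · refine (M.v_le _ _ (Q i) ?_).trans (h.res_le a i)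
      rintro g (hg | hg) hr'
      · exact ((hkb' a hr).2 g hg hr').elim
      · exact hg
    · refine (M.v_le _ _ (X k) ?_).trans (h.root_le a k hk)
      rintro g (hg | hg) hr'
      · exact hg
      · exact (hr (h.reserve.parallel i g hg e he a hr')).elim
  have hQ : ∀ j, Function.update Q i ∅ j ⊆ Q j := by
    intro j
    by_cases hj : j = i
    · subst hj; simp
    · simp [hj]
  have hQi : ∀ j, Disjoint (Q i) (Function.update Q i ∅ j) := by
    intro j
    by_cases hj : j = i
    · subst hj; simp
    · simpa [hj] using h.reserve.disj i j (Ne.symm hj)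
  refine ⟨⟨fun j g hg => h.reserve.rel j g (hQ j hg), fun j g hg g' hg' =>
      h.reserve.parallel j g (hQ j hg) g' (hQ j hg'),
      fun a b hab => (h.reserve.disj a b hab).mono (hQ a) (hQ b)⟩, fun a b hab => ?_,
    fun a b => ?_, fun a b g hg => ?_, fun a b hb => ?_,
    fun a b => ((v_mono (hQ b)).trans (h.res_le a b)).trans (hup a), fun a => ?_, fun g => ?_⟩
  · by_cases ha : a = k <;> by_cases hb : b = k
    · exact (hab (ha.trans hb.symm)).elim
    · subst ha
      simpa [hb] using ⟨h.disj a b hab, (h.disj_res b i).symm⟩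
    · subst hb
      simpa [ha] using ⟨h.disj a b hab, h.disj_res a i⟩
    · simpa [ha, hb] using h.disj a b hab
  · by_cases ha : a = k
    · subst ha
      rw [Function.update_self]
      exact ((h.disj_res a b).mono_right (hQ b)).union_left (hQi b)
    · rw [Function.update_of_ne ha]
      exact (h.disj_res a b).mono_right (hQ b)
  · by_cases hb : b = k
    · subst hb
      rw [Function.update_self]
      exact (v_mono Set.sdiff_subset).trans (hroot a)
    · rw [Function.update_of_ne hb] at hg ⊢
      exact (h.efx a b g hg).trans (hup a)
  · by_cases hbk : b = k
    · subst hbk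
      rw [Function.update_self]
      exact hroot a
    · rw [Function.update_of_ne hbk]
      exact (h.root_le a b hb).trans (hup a)
  · refine ((v_mono fun g hg j => ?_).trans (h.pool_le a)).trans (hup a)
    have hgk := (hg k).1
    rw [Function.update_self] at hgk
    refine ⟨?_, ?_⟩
    · by_cases hj : j = k
      · subst hj; exact fun h1 => hgk (Or.inl h1)
      · simpa [hj] using (hg j).1
    · by_cases hj : j = i
      · subst hj; exact fun h1 => hgk (Or.inr h1)
      · simpa [hj] using (hg j).2
  · refine lt_of_le_of_lt ?_ (h.card_lt g)
    -- Only a touching bundle can make `k` blocked for `g`, and `touching` then loses `i` in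
    -- exchange.
    by_cases ht : i ∈ touching M Q g
    · have h1 : blocked M ρ (Function.update X k (X k ∪ Q i)) g ⊆ insert k (blocked M ρ X g) := by
        rintro j ⟨hj, a, ha, h2⟩
        by_cases hjk : j = k
        · exact Or.inl hjk
        · rw [Function.update_of_ne hjk] at h2
          exact Or.inr ⟨hj, a, ha, h2⟩
      have h2 : touching M (Function.update Q i ∅) g ⊆ touching M Q g \ {i} := by
        rintro j ⟨a, ha, g', hg', hr⟩
        refine ⟨⟨a, ha, g', hQ j hg', hr⟩, ?_⟩
        rintro rfl
        simp at hg'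
      have h3 := (Set.ncard_le_ncard h1 (Set.toFinite _)).trans (Set.ncard_insert_le _ _)
      have h4 := Set.ncard_le_ncard h2 (Set.toFinite _)
      have h5 := Set.ncard_sdiff_singleton_add_one ht (Set.toFinite _)
      omega
    · refine add_le_add (Set.ncard_le_ncard ?_ (Set.toFinite _))
        (Set.ncard_le_ncard ?_ (Set.toFinite _))
      · rintro j ⟨hj, a, ha, h2⟩
        refine ⟨hj, a, ha, h2.imp_right ?_⟩
        rintro ⟨g', hg', hr⟩
        by_cases hjk : j = k
        · subst hjk
          rw [Function.update_self] at hg'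
          rcases hg' with hg' | hg'
          · exact ⟨g', hg', hr⟩
          · exact (ht ⟨a, ha, g', hg', hr⟩).elim
        · rw [Function.update_of_ne hjk] at hg'
          exact ⟨g', hg', hr⟩
      · rintro j ⟨a, ha, g', hg', hr⟩
        exact ⟨a, ha, g', hQ j hg', hr⟩

/-- The whole reserve can be handed out. -/
theorem exists_empty_reserve [Finite V] (h : IsSpread M Q ρ X) :
    ∃ X, IsSpread M (fun _ => ∅) ρ X := by
  classical
  obtain ⟨n, hn⟩ : ∃ n, {i | (Q i).Nonempty}.ncard = n := ⟨_, rfl⟩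
  induction n generalizing Q X with
  | zero =>
    rw [Set.ncard_eq_zero] at hn
    have : Q = fun _ => ∅ := by
      funext i
      by_contra hi
      have : i ∈ {i | (Q i).Nonempty} := Set.nonempty_iff_ne_empty.2 hi
      rw [hn] at this
      exact this
    exact ⟨X, this ▸ h⟩
  | succ n ih =>
    obtain ⟨i, hi⟩ : {i | (Q i).Nonempty}.Nonempty := by
      rw [← Set.ncard_pos]; omega
    obtain ⟨e, he⟩ := hi
    obtain ⟨k, hk, hkb⟩ := h.exists_not_blocked e
    refine ih (h.give he hk hkb) ?_
    have h1 : {j | (Function.update Q i ∅ j).Nonempty} = {j | (Q j).Nonempty} \ {i} := by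
      ext j
      by_cases hj : j = i
      · subst hj; simp
      · simp [hj]
    have h2 : i ∈ {i | (Q i).Nonempty} := ⟨e, he⟩
    rw [h1, Set.ncard_sdiff_singleton_of_mem h2, hn, Nat.add_sub_cancel]

/-- The unallocated goods can be handed out. -/
theorem exists_complete (h : IsSpread M (fun _ => ∅) ρ X) :
    ∃ Y : V → Set E, (∀ i j, i ≠ j → Disjoint (Y i) (Y j)) ∧ (∀ g, ∃ i, g ∈ Y i) ∧
      ∀ i j, ∀ g ∈ Y j, M.v i (Y j \ {g}) ≤ M.v i (Y i) := by
  choose κ hκ hκb using h.exists_not_blocked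
  let P := pool X (fun _ => (∅ : Set E))
  have hP : ∀ g, g ∉ P → ∃ i, g ∈ X i := by
    intro g hg
    by_contra! hc
    exact hg fun k => ⟨hc k, id⟩
  refine ⟨fun k => X k ∪ {g | g ∈ P ∧ κ g = k}, fun i j hij => ?_, fun g => ?_,
    fun i j g hg => ?_⟩
  · refine Set.disjoint_left.2 ?_
    rintro g (h1 | h1) (h2 | h2)
    · exact Set.disjoint_left.1 (h.disj i j hij) h1 h2
    · exact (h2.1 i).1 h1
    · exact (h1.1 j).1 h2
    · exact hij (h1.2.symm.trans h2.2)
  · by_cases hg : g ∈ P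
    · exact ⟨κ g, Or.inr ⟨hg, rfl⟩⟩
    · obtain ⟨i, hi⟩ := hP g hg
      exact ⟨i, Or.inl hi⟩
  · by_cases hij : i = j
    · subst hij; exact v_mono Set.sdiff_subset
    refine le_trans ?_ (v_mono (S := X i) Set.subset_union_left)
    -- By the choice of `κ`, agent `i` sees in the bundle of `j` either only pool goods or only
    -- goods of `X j`.
    by_cases hr : ∃ e ∈ P, κ e = j ∧ M.rel i e
    · obtain ⟨e, heP, rfl, hr⟩ := hr
      refine (M.v_le _ _ P ?_).trans (h.pool_le i)
      rintro g' ⟨hg' | hg', _⟩ hr'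
      · exact (hκb e ⟨hκ e, i, hr, Or.inr ⟨g', hg', hr'⟩⟩).elim
      · exact hg'.1
    · push Not at hr
      rcases hg with hg | hg
      · refine (M.v_le _ _ (X j \ {g}) ?_).trans (h.efx i j g hg)
        rintro g' ⟨hg' | hg', hne⟩ hr'
        · exact ⟨hg', hne⟩
        · exact (hr g' hg'.1 hg'.2 hr').elim
      · refine (M.v_le _ _ (X j) ?_).trans (h.root_le i j (hg.2 ▸ hκ g))
        rintro g' ⟨hg' | hg', hne⟩ hr'
        · exact hg'
        · exact (hr g' hg'.1 hg'.2 hr').elim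

end IsSpread

/-! ### Counting neighbours -/

/-- The agents interested in a good and their neighbours are few. -/
theorem ncard_interested_le [Finite V] {δ : ℕ} (hδ : 1 ≤ δ) (hdeg : ∀ i, (M.nbrs i).ncard ≤ δ)
    (g : E) : {k | ∃ a, M.rel a g ∧ (k = a ∨ k ∈ M.nbrs a)}.ncard ≤ 2 * δ := by
  by_cases h2 : ∃ a b, a ≠ b ∧ M.rel a g ∧ M.rel b g
  · obtain ⟨a, b, hab, ha, hb⟩ := h2
    -- The endpoints cost nothing extra, each being a neighbour of the other.
    refine (Set.ncard_le_ncard (t := M.nbrs a ∪ M.nbrs b) ?_ (Set.toFinite _)).trans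
      ((Set.ncard_union_le _ _).trans (by linarith [hdeg a, hdeg b]))
    rintro k ⟨c, hc, hk⟩
    rcases M.rel_two g c a b hc ha hb with rfl | rfl | h3
    · rcases hk with rfl | hk
      · exact Or.inr ⟨hab, g, hb, ha⟩
      · exact Or.inl hk
    · rcases hk with rfl | hk
      · exact Or.inl ⟨hab.symm, g, ha, hb⟩
      · exact Or.inr hk
    · exact (hab h3).elim
  · push Not at h2
    by_cases h1 : ∃ a, M.rel a g
    · obtain ⟨a, ha⟩ := h1
      -- Here `a` itself is extra, and `1 ≤ δ` pays for it.
      refine (Set.ncard_le_ncard (t := insert a (M.nbrs a)) ?_ (Set.toFinite _)).trans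
        ((Set.ncard_insert_le _ _).trans (by linarith [hdeg a]))
      rintro k ⟨c, hc, hk⟩
      have : c = a := by
        by_contra hca
        exact h2 c a hca hc ha
      subst this
      exact hk
    · push Not at h1
      have : {k | ∃ a, M.rel a g ∧ (k = a ∨ k ∈ M.nbrs a)} = ∅ := by
        ext k
        simp [h1]
      rw [this, Set.ncard_empty]
      exact Nat.zero_le _

theorem IsConfig.isSpread [Finite V] {d : ℕ} {Q : V → Set E} {ρ : Finset V} {X : V → Set E}
    (h : IsConfig M d Q ρ X) (hQ : IsReserve M Q) (hpool : ∀ i, M.v i (pool X Q) ≤ M.v i (X i))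
    (hd : ∀ g, {k | ∃ a, M.rel a g ∧ (k = a ∨ k ∈ M.nbrs a)}.ncard ≤ d) : IsSpread M Q ρ X := by
  classical
  refine ⟨hQ, h.disj, h.disj_res, h.efx, h.root_le, h.res_le, hpool, fun g => ?_⟩
  have hW : ∀ k a e, M.rel a g → M.rel a e → M.rel k e → k = a ∨ k ∈ M.nbrs a := by
    intro k a e ha he hk
    by_cases hka : k = a
    · exact Or.inl hka
    · exact Or.inr ⟨hka, e, he, hk⟩
  -- Blocked roots and touching non-roots are disjoint and lie in one neighbourhood of size at most
  -- `d`; touching roots are paid for by `card_lt`.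
  have h1 : (blocked M ρ X g ∪ (touching M Q g \ (ρ : Set V))).ncard ≤ d := by
    refine (Set.ncard_le_ncard ?_ (Set.toFinite _)).trans (hd g)
    rintro k (⟨hk, a, ha, rfl | ⟨e, he, hr⟩⟩ | ⟨⟨a, ha, e, he, hr⟩, _⟩)
    · exact ⟨k, ha, Or.inl rfl⟩
    · exact ⟨a, ha, hW k a e ha hr (h.rel k e he)⟩
    · exact ⟨a, ha, hW k a e ha hr (hQ.rel k e he)⟩
  rw [Set.ncard_union_eq (Set.disjoint_left.2 fun k hk hk' => hk'.2 hk.1) (Set.toFinite _)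
    (Set.toFinite _)] at h1
  have h2 : (touching M Q g ∩ (ρ : Set V)).ncard ≤ {i ∈ ρ | (Q i).Nonempty}.card := by
    rw [← Set.ncard_coe_finset]
    refine Set.ncard_le_ncard ?_ (Set.toFinite _)
    rintro k ⟨⟨a, ha, e, he, hr⟩, hk⟩
    simp only [Finset.coe_filter]
    exact ⟨hk, e, he⟩
  have h3 := Set.ncard_inter_add_ncard_sdiff_eq_ncard (touching M Q g) (ρ : Set V) (Set.toFinite _)
  have h4 := h.card_lt
  have h5 : {i ∈ ρ | (Q i).Nonempty}.card =
    (@Finset.filter _ (fun j => (Q j).Nonempty) (fun _ => Classical.propDecidable _) ρ).card := by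
    congr
  omega

/-- If every agent has fewer than a quarter of the agents as neighbours, then a complete EFX
allocation exists. -/
theorem exists_complete_efx [Finite V] [Finite E] (M : Market V E)
    (hrel : ∀ g, ∃ a, M.rel a g) (hdeg : ∀ i, 4 * (M.nbrs i).ncard < Nat.card V) :
    ∃ Y : V → Set E, (∀ i j, i ≠ j → Disjoint (Y i) (Y j)) ∧ (∀ g, ∃ i, g ∈ Y i) ∧
      ∀ i j, ∀ g ∈ Y j, M.v i (Y j \ {g}) ≤ M.v i (Y i) := by
  have := Fintype.ofFinite V
  rw [Nat.card_eq_fintype_card] at hdeg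
  -- Here nobody has neighbours, so each good goes to the only agent interested in it. For larger
  -- `n` the degree bound is at least `1`, as the count requires.
  by_cases hn : Fintype.card V ≤ 4
  · choose κ hκ using hrel
    refine ⟨fun i => {g | κ g = i}, fun i j hij => ?_, fun g => ⟨κ g, rfl⟩, fun i j g _ => ?_⟩
    · exact Set.disjoint_left.2 fun g h1 h2 => hij (h1.symm.trans h2)
    · refine M.v_le _ _ _ ?_
      rintro e ⟨rfl, -⟩ hr
      by_contra hne
      have h1 : κ e ∈ M.nbrs i := ⟨hne, e, hr, hκ e⟩
      have h2 := Set.ncard_pos (Set.toFinite (M.nbrs i)) |>.2 ⟨_, h1⟩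
      have := hdeg i
      omega
  -- The largest degree allowed is `(n - 1) / 4`, rounded down; `d` is twice that, so `2 * d ≤ n -
  -- 1`.
  · obtain ⟨Q, ρ, X, hQ, h⟩ := M.exists_config (d := 2 * ((Fintype.card V - 1) / 4)) (by omega)
    obtain ⟨ρ, X, h, hpool⟩ := h.exists_pool_le
    obtain ⟨X, h⟩ := (h.isSpread hQ hpool (ncard_interested_le (by omega) fun i => by
      have := hdeg i
      omega)).exists_empty_reserve
    exact h.exists_complete

end Market
-- Multigraphs as markets
variable {α β : Type*} {G : Graph α β}

/-- Irrelevance concerns one good at a time; finiteness of the edge set allows induction over all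
irrelevant goods. -/
theorem IsValuation.le_of_relevant {i : Agent G} {v : Set (Good G) → ℝ} (hv : IsValuation G i v)
    (hE : G.edgeSet.Finite) {S T : Set (Good G)} (h : ∀ g ∈ S, Relevant G i g → g ∈ T) :
    v S ≤ v T := by
  have : Finite (Good G) := hE
  have key : ∀ U : Set (Good G), (∀ g ∈ U, ¬ Relevant G i g) → v (T ∪ U) = v T := by
    intro U
    induction U, U.toFinite using Set.Finite.induction_on with
    | empty => simp
    | insert _ _ ih =>
      intro hU
      rw [Set.insert_eq, Set.union_comm {_}, ← Set.union_assoc,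
        hv.irrelevant _ _ (hU _ (Set.mem_insert _ _)),
        ih fun g hg => hU g (Set.mem_insert_of_mem _ hg)]
  rw [← key (S \ T) fun g hg hr => hg.2 (h g hg.1 hr), Set.union_sdiff_self]
  exact hv.mono _ _ Set.subset_union_right

/-- The market of a multigraph whose goods are relevant to their endpoints. -/
def market (G : Graph α β) (hE : G.edgeSet.Finite) (v : Agent G → Set (Good G) → ℝ)
    (hv : ∀ i, IsValuation G i (v i)) : Market (Agent G) (Good G) where
  rel := Relevant G
  rel_two g a b c ha hb hc := by
    simpa only [Subtype.ext_iff] using Graph.Inc.eq_or_eq_or_eq ha hb hc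
  v := v
  v_empty i := (hv i).empty
  v_le i _ _ h := (hv i).le_of_relevant hE h

theorem exists_relevant (g : Good G) : ∃ i : Agent G, Relevant G i g := by
  obtain ⟨x, y, h⟩ := Graph.exists_isLink_of_mem_edgeSet g.2
  exact ⟨⟨x, h.left_mem⟩, h.inc_left⟩

theorem nbrs_market_subset {hE : G.edgeSet.Finite} {v : Agent G → Set (Good G) → ℝ}
    {hv : ∀ i, IsValuation G i (v i)} (i : Agent G) :
    (market G hE v hv).nbrs i ⊆ neighbors G i := by
  rintro j ⟨hji, g, ⟨y, hi⟩, hj⟩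
  obtain rfl := Graph.Inc.eq_of_isLink_of_ne_left hj hi fun h => hji (Subtype.ext h)
  exact ⟨hji, g, hi⟩

end MultigraphEFX

theorem theorem2 {α : Type*} {β : Type*} (G : Graph α β)
    (hV : G.vertexSet.Finite) (hE : G.edgeSet.Finite)
    (v : MultigraphEFX.Agent G → Set (MultigraphEFX.Good G) → ℝ)
    (hv : ∀ i, MultigraphEFX.IsValuation G i (v i))
    (hdeg : ∀ i : MultigraphEFX.Agent G,
      ((MultigraphEFX.neighbors G i).ncard : ℤ) ≤ ⌈(G.vertexSet.ncard : ℝ) / 4⌉ - 1) :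
    ∃ X : MultigraphEFX.Agent G → Set (MultigraphEFX.Good G),
      MultigraphEFX.IsCompleteAllocation G X ∧ MultigraphEFX.IsEFX G v X := by
  have : Finite (MultigraphEFX.Agent G) := hV
  have : Finite (MultigraphEFX.Good G) := hE
  obtain ⟨X, hdisj, hcover, hefx⟩ :=
    (MultigraphEFX.market G hE v hv).exists_complete_efx MultigraphEFX.exists_relevant fun i => by
      have h1 := Set.ncard_le_ncard
        (MultigraphEFX.nbrs_market_subset (hE := hE) (hv := hv) i) (Set.toFinite _)
      -- At most `⌈n/4⌉ - 1` means strictly below `n/4`.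
      have h2 := Int.lt_ceil.1 (Int.le_sub_one_iff.1 (hdeg i))
      rw [lt_div_iff₀ four_pos, Int.cast_natCast] at h2
      have h3 : (MultigraphEFX.neighbors G i).ncard * 4 < G.vertexSet.ncard := mod_cast h2
      rw [Nat.card_coe_set_eq]
      omega
  exact ⟨X, ⟨hdisj, Set.iUnion_eq_univ_iff.2 hcover⟩, hefx⟩
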